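/- Let $I,J\ge 1$ be fixed, let $w_1,\dots,w_I\in\mathbb R$ be temperatures, not all equal, and $t_1,\dots,t_J>0$ inspection times. Let $\Theta=(0,\infty)\times\mathbb R$ and for $\boldsymbol\alpha=(\alpha_0,\alpha_1)\in\Theta$ put $\lambda_{w}(\boldsymbol\alpha)=\alpha_0e^{\alpha_1 w}$, $F(t|\lambda)=1-e^{-\lambda t}$, $f(t|\lambda)=\lambda e^{-\lambda t}$ and $\pi_{ij}(\boldsymbol\alpha)=F(t_j|\lambda_{w_i}(\boldsymbol\alpha))$. Let $\boldsymbol\alpha_0\in\Theta$ be the true parameter, let $y_{ijk}$ ($1\le i\le I$, $1\le j\le J$, $k\ge 1$) be independent Bernoulli random variables with $P(y_{ijk}=1)=\pi_{ij}(\boldsymbol\alpha_0)$, and put $n_{ij}=\sum_{k=1}^K y_{ijk}$. Let $\beta\ge 0$. A minimum density power divergence estimate (MDPDE) based on $K$ devices per cell is a minimiser over $\boldsymbol\alpha\in\Theta$ of $$\frac1{IJK}\sum_{i=1}^I\sum_{j=1}^J\sum_{k=1}^K\Big\{\pi_{ij}(\boldsymbol\alpha)^{\beta+1}+(1-\pi_{ij}(\boldsymbol\alpha))^{\beta+1}-\tfrac{1+\beta}{\beta}\big(\pi_{ij}(\boldsymbol\alpha)^{y_{ijk}}(1-\pi_{ij}(\boldsymbol\alpha))^{1-y_{ijk}}\big)^{\beta}\Big\}$$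 if $\beta>0$, and of the Kullback--Leibler divergence $$\frac1{IJ}\sum_{i=1}^I\sum_{j=1}^J\Big(\tfrac{n_{ij}}K\log\tfrac{n_{ij}}{K\pi_{ij}(\boldsymbol\alpha)}+\tfrac{K-n_{ij}}K\log\tfrac{K-n_{ij}}{K(1-\pi_{ij}(\boldsymbol\alpha))}\Big)\qquad(0\log 0=0)$$ if $\beta=0$. Let $\widehat{\boldsymbol\alpha}_\beta=\widehat{\boldsymbol\alpha}_{\beta,K}$ be any random vectors that are almost surely equal to an MDPDE whenever one exists (and arbitrary otherwise). Define $$\bar{\boldsymbol J}_\beta(\boldsymbol\alpha)=\sum_{i=1}^I\begin{pmatrix}\alpha_0^{-2}&w_i/\alpha_0\\ w_i/\alpha_0&w_i^2\end{pmatrix}\sum_{j=1}^Jt_j^2f_{ij}^2\big[F_{ij}^{\beta-1}+(1-F_{ij})^{\beta-1}\big],$$ $$\bar{\boldsymbol K}_\beta(\boldsymbol\alpha)=\sum_{i=1}^I\begin{pmatrix}\alpha_0^{-2}&w_i/\alpha_0\\ w_i/\alpha_0&w_i^2\end{pmatrix}\sum_{j=1}^Jt_j^2f_{ij}^2\Big\{\big[F_{ij}^{2\beta-1}+(1-F_{ij})^{2\beta-1}\big]-\big[F_{ij}^{\beta}-(1-F_{ij})^{\beta}\big]^2\Big\},$$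 where $F_{ij}=F(t_j|\lambda_{w_i}(\boldsymbol\alpha))$ and $f_{ij}=f(t_j|\lambda_{w_i}(\boldsymbol\alpha))$. Then, as $K\to\infty$, the probability that an MDPDE exists tends to $1$; the matrix $\bar{\boldsymbol J}_\beta(\boldsymbol\alpha_0)$ is invertible, the matrix $\bar{\boldsymbol J}_\beta^{-1}(\boldsymbol\alpha_0)\bar{\boldsymbol K}_\beta(\boldsymbol\alpha_0)\bar{\boldsymbol J}_\beta^{-1}(\boldsymbol\alpha_0)$ is positive semidefinite, and $$\sqrt K\,(\widehat{\boldsymbol\alpha}_\beta-\boldsymbol\alpha_0)\ \xrightarrow{\ \mathcal L\ }\ \mathcal N\big(\boldsymbol 0,\ \bar{\boldsymbol J}_\beta^{-1}(\boldsymbol\alpha_0)\,\bar{\boldsymbol K}_\beta(\boldsymbol\alpha_0)\,\bar{\boldsymbol J}_\beta^{-1}(\boldsymbol\alpha_0)\big).$$ -/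

import Mathlib

open MeasureTheory ProbabilityTheory Filter Topology

namespace OneShot

/-- Parameter vectors `α = (α 0, α 1)`, with the Euclidean norm. -/
abbrev Param : Type := EuclideanSpace ℝ (Fin 2)

/-- The parameter space `Θ = (0, ∞) × ℝ`. -/
def paramSpace : Set Param := {α | 0 < α 0}

/-- Failure rate at temperature `w` under the log-linear link: `α 0 * exp (α 1 * w)`. -/
noncomputable def rate (w : ℝ) (α : Param) : ℝ := α 0 * Real.exp (α 1 * w)

/-- Exponential distribution function `F(t | λ)` at times `t ≥ 0`. -/
noncomputable def expF (t lam : ℝ) : ℝ := 1 - Real.exp (-lam * t)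

/-- Exponential density `f(t | λ)` at times `t ≥ 0`. -/
noncomputable def expf (t lam : ℝ) : ℝ := lam * Real.exp (-lam * t)

/-- The probability that a device fails before time `t` at temperature `w`. -/
noncomputable def failProb (w t : ℝ) (α : Param) : ℝ := expF t (rate w α)

theorem failProb_mem (w : ℝ) {t : ℝ} (ht : 0 < t) {α : Param} (hα : α ∈ paramSpace) :
    failProb w t α ∈ unitInterval := by
  have h0 : 0 < α 0 := hα
  have h : 0 ≤ rate w α * t := by unfold rate; positivity
  refine ⟨?_, ?_⟩
  · have : Real.exp (-rate w α * t) ≤ 1 := Real.exp_le_one_iff.2 (by linarith)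
    simpa [failProb, expF] using this
  · have : 0 ≤ Real.exp (-rate w α * t) := (Real.exp_pos _).le
    simpa [failProb, expF] using this

/-- The failure probability as an element of `[0, 1]`. -/
noncomputable def failProbI (w : ℝ) {t : ℝ} (ht : 0 < t) {α : Param} (hα : α ∈ paramSpace) :
    unitInterval := ⟨failProb w t α, failProb_mem w ht hα⟩

section Estimation

variable {I J : ℕ}

/-- Number of failures `n i j` among the first `K` devices of cell `(i, j)`. -/
def failures (y : Fin I → Fin J → ℕ → ℕ) (K : ℕ) (i : Fin I) (j : Fin J) : ℕ :=
  ∑ k ∈ Finset.range K, y i j k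

/-- Kullback-Leibler divergence between the observed and the theoretical probability vectors
(with `0 * log 0 = 0`). -/
noncomputable def klDivergence (w : Fin I → ℝ) (t : Fin J → ℝ) (K : ℕ)
    (y : Fin I → Fin J → ℕ → ℕ) (α : Param) : ℝ :=
  1 / ((I : ℝ) * J) * ∑ i, ∑ j,
    ((failures y K i j : ℝ) / K *
        Real.log ((failures y K i j : ℝ) / (K * failProb (w i) (t j) α)) +
      ((K : ℝ) - failures y K i j) / K *
        Real.log (((K : ℝ) - failures y K i j) / (K * (1 - failProb (w i) (t j) α))))

/-- Contribution of one Bernoulli observation `y ∈ {0, 1}` with success probability `p` to the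
density power divergence criterion with tuning parameter `β > 0`. -/
noncomputable def V (β p : ℝ) (y : ℕ) : ℝ :=
  p ^ (β + 1) + (1 - p) ^ (β + 1) - (1 + β) / β * (p ^ y * (1 - p) ^ (1 - y)) ^ β

/-- The function of `α` minimised by the minimum density power divergence estimator: the averaged
density power divergence criterion for `β > 0`, and the Kullback-Leibler divergence for `β = 0`. -/
noncomputable def criterion (β : ℝ) (w : Fin I → ℝ) (t : Fin J → ℝ) (K : ℕ)
    (y : Fin I → Fin J → ℕ → ℕ) (α : Param) : ℝ :=
  if β = 0 then klDivergence w t K y α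
  else 1 / ((I : ℝ) * J * K) *
    ∑ i, ∑ j, ∑ k ∈ Finset.range K, V β (failProb (w i) (t j) α) (y i j k)

/-- `a` is a minimum density power divergence estimate: a minimiser of the criterion over `Θ`. -/
def IsMDPDE (β : ℝ) (w : Fin I → ℝ) (t : Fin J → ℝ) (K : ℕ)
    (y : Fin I → Fin J → ℕ → ℕ) (a : Param) : Prop :=
  a ∈ paramSpace ∧ IsMinOn (criterion β w t K y) paramSpace a

/-- The `2 × 2` matrix attached to the temperature `w`. -/
noncomputable def tempMatrix (w : ℝ) (α : Param) : Matrix (Fin 2) (Fin 2) ℝ :=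
  !![1 / α 0 ^ 2, w / α 0; w / α 0, w ^ 2]

/-- The matrix `J̄_β(α)`. -/
noncomputable def Jbar (β : ℝ) (w : Fin I → ℝ) (t : Fin J → ℝ) (α : Param) :
    Matrix (Fin 2) (Fin 2) ℝ :=
  ∑ i, (∑ j, t j ^ 2 * expf (t j) (rate (w i) α) ^ 2 *
      (expF (t j) (rate (w i) α) ^ (β - 1) + (1 - expF (t j) (rate (w i) α)) ^ (β - 1))) •
    tempMatrix (w i) α

/-- The matrix `K̄_β(α)`. -/
noncomputable def Kbar (β : ℝ) (w : Fin I → ℝ) (t : Fin J → ℝ) (α : Param) :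
    Matrix (Fin 2) (Fin 2) ℝ :=
  ∑ i, (∑ j, t j ^ 2 * expf (t j) (rate (w i) α) ^ 2 *
      ((expF (t j) (rate (w i) α) ^ (2 * β - 1) +
          (1 - expF (t j) (rate (w i) α)) ^ (2 * β - 1)) -
        (expF (t j) (rate (w i) α) ^ β - (1 - expF (t j) (rate (w i) α)) ^ β) ^ 2)) •
    tempMatrix (w i) α

/-- The asymptotic covariance matrix `J̄_β(α)⁻¹ K̄_β(α) J̄_β(α)⁻¹`. -/
noncomputable def asymptoticCov (β : ℝ) (w : Fin I → ℝ) (t : Fin J → ℝ) (α : Param) :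
    Matrix (Fin 2) (Fin 2) ℝ :=
  (Jbar β w t α)⁻¹ * Kbar β w t α * (Jbar β w t α)⁻¹

end Estimation

end OneShot

/-! For every `β ≥ 0` the criterion is a positive affine function of a sum over cells of `dpdLoss β
q p`, where `q` is the observed frequency and `p` the model probability. The derivative of this loss
in `p` is `(p - q) * lossWeight β p` with a positive weight, so each cell's loss decreases up to `p
= q` and increases afterwards. This treats `β = 0` and `β > 0` together.

Everything about minimisers is then deterministic in the vector `q`, for `q` near the true
probabilities. Two cells at different temperatures recover the parameter continuously
(`paramOfProbs`), so a parameter away from `α₀` misses some true cell probability by a fixed margin.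
By monotonicity that cell alone costs more than `α₀` does (`eventually_forall_totalLoss_lt`), so
minimisers exist by compactness of a small ball and lie near `α₀`. Linearising the score equation
gives `a - α₀ = J̄⁻¹ ∑ (q - p) • weight • gradient + o(‖q - p‖)`, uniformly over minimisers
(`eventually_norm_isMinOn_totalLoss_sub_le`).

Probability enters only through `q`. Chebyshev's inequality gives `q - p` the order `1 / √K`, so the
remainder times `√K` vanishes in probability (`tendstoInMeasure_sqrt_smul`). The linear term obeys
the central limit theorem (`tendstoInDistribution_sum_smul_rows`), and Slutsky's lemma combines the
two. The Bernoulli variances `p * (1 - p)` turn the outer products of the weighted gradients into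
`K̄` (`Kbar_eq`). -/

namespace OneShot

/-! ### The loss of a single cell -/

/-- Derivative of `lossB`. -/
noncomputable def lossWeight (β p : ℝ) : ℝ := p ^ (β - 1) + (1 - p) ^ (β - 1)

/-- The part of the density power divergence loss that does not depend on the observed
frequency. -/
noncomputable def lossA (β p : ℝ) : ℝ :=
  if β = 0 then -Real.log (1 - p)
  else (p ^ (β + 1) + (1 - p) ^ (β + 1)) / (1 + β) - (1 - p) ^ β / β

/-- The coefficient of minus the observed frequency in the density power divergence loss. -/
noncomputable def lossB (β p : ℝ) : ℝ :=
  if β = 0 then Real.log p - Real.log (1 - p) else (p ^ β - (1 - p) ^ β) / β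

/-- The density power divergence between Bernoulli laws with success probabilities `q` (observed)
and `p` (model), up to a positive factor and a summand depending on `q` only. -/
noncomputable def dpdLoss (β q p : ℝ) : ℝ := lossA β p - q * lossB β p

theorem lossWeight_pos (β : ℝ) {p : ℝ} (h : p ∈ Set.Ioo (0 : ℝ) 1) : 0 < lossWeight β p :=
  add_pos (Real.rpow_pos_of_pos h.1 _) (Real.rpow_pos_of_pos (sub_pos.2 h.2) _)

theorem continuousAt_lossWeight (β : ℝ) {p : ℝ} (h : p ∈ Set.Ioo (0 : ℝ) 1) :
    ContinuousAt (lossWeight β) p := by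
  have h1 : 1 - p ≠ 0 := (sub_pos.2 h.2).ne'
  exact (continuousAt_id.rpow_const (Or.inl h.1.ne')).add
    ((continuousAt_const.sub continuousAt_id).rpow_const (Or.inl h1))

theorem hasDerivAt_lossB {β : ℝ} {p : ℝ} (h : p ∈ Set.Ioo (0 : ℝ) 1) :
    HasDerivAt (lossB β) (lossWeight β p) p := by
  have h0 : p ≠ 0 := h.1.ne'
  have h1 : 1 - p ≠ 0 := (sub_pos.2 h.2).ne'
  have hs : HasDerivAt (fun x : ℝ => 1 - x) (-1) p := by
    simpa using (hasDerivAt_id p).const_sub 1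
  by_cases hβ : β = 0
  · have e : lossB β = fun x => Real.log x - Real.log (1 - x) := by
      funext x; simp [lossB, hβ]
    rw [e]
    refine ((Real.hasDerivAt_log h0).sub (hs.log h1)).congr_deriv ?_
    rw [lossWeight, hβ, zero_sub, Real.rpow_neg_one, Real.rpow_neg_one]
    field_simp
    ring
  · have e : lossB β = fun x => (x ^ β - (1 - x) ^ β) / β := by
      funext x; simp [lossB, hβ]
    rw [e]
    refine (((Real.hasDerivAt_rpow_const (p := β) (Or.inl h0)).sub
      (hs.rpow_const (p := β) (Or.inl h1))).div_const β).congr_deriv ?_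
    rw [lossWeight]
    field_simp
    ring

theorem hasDerivAt_lossA {β : ℝ} (hβ' : 0 ≤ β) {p : ℝ} (h : p ∈ Set.Ioo (0 : ℝ) 1) :
    HasDerivAt (lossA β) (p * lossWeight β p) p := by
  have h0 : p ≠ 0 := h.1.ne'
  have h1 : 1 - p ≠ 0 := (sub_pos.2 h.2).ne'
  have hs : HasDerivAt (fun x : ℝ => 1 - x) (-1) p := by
    simpa using (hasDerivAt_id p).const_sub 1
  by_cases hβ : β = 0
  · have e : lossA β = fun x => - Real.log (1 - x) := by
      funext x; simp [lossA, hβ]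
    rw [e]
    refine (hs.log h1).neg.congr_deriv ?_
    rw [lossWeight, hβ, zero_sub, Real.rpow_neg_one, Real.rpow_neg_one]
    field_simp
    ring
  · have e : lossA β = fun x =>
        (x ^ (β + 1) + (1 - x) ^ (β + 1)) / (1 + β) - (1 - x) ^ β / β := by
      funext x; simp [lossA, hβ]
    rw [e]
    have hβ1 : 1 + β ≠ 0 := by positivity
    refine ((((Real.hasDerivAt_rpow_const (p := β + 1) (Or.inl h0)).add
      (hs.rpow_const (p := β + 1) (Or.inl h1))).div_const (1 + β)).sub
      ((hs.rpow_const (p := β) (Or.inl h1)).div_const β)).congr_deriv ?_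
    have e1 : p ^ (β + 1 - 1) = p ^ (β - 1) * p := by
      rw [← Real.rpow_add_one h0]; ring_nf
    have e2 : (1 - p) ^ (β + 1 - 1) = (1 - p) ^ (β - 1) * (1 - p) := by
      rw [← Real.rpow_add_one h1]; ring_nf
    rw [lossWeight, e1, e2]
    field_simp
    ring

theorem hasDerivAt_dpdLoss {β : ℝ} (hβ : 0 ≤ β) (q : ℝ) {p : ℝ} (h : p ∈ Set.Ioo (0 : ℝ) 1) :
    HasDerivAt (dpdLoss β q) ((p - q) * lossWeight β p) p :=
  ((hasDerivAt_lossA hβ h).sub ((hasDerivAt_lossB h).const_mul q)).congr_deriv (by ring)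

theorem strictAntiOn_dpdLoss {β : ℝ} (hβ : 0 ≤ β) {q : ℝ} (hq : q < 1) :
    StrictAntiOn (dpdLoss β q) (Set.Ioc 0 q) := by
  have hd : ∀ x ∈ Set.Ioc 0 q, HasDerivAt (dpdLoss β q) ((x - q) * lossWeight β x) x :=
    fun x hx => hasDerivAt_dpdLoss hβ q ⟨hx.1, hx.2.trans_lt hq⟩
  refine strictAntiOn_of_deriv_neg (convex_Ioc 0 q)
    (fun x hx => (hd x hx).continuousAt.continuousWithinAt) fun x hx => ?_
  rw [interior_Ioc] at hx
  rw [(hd x ⟨hx.1, hx.2.le⟩).deriv]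
  exact mul_neg_of_neg_of_pos (sub_neg.2 hx.2) (lossWeight_pos β ⟨hx.1, hx.2.trans hq⟩)

theorem strictMonoOn_dpdLoss {β : ℝ} (hβ : 0 ≤ β) {q : ℝ} (hq : 0 < q) :
    StrictMonoOn (dpdLoss β q) (Set.Ico q 1) := by
  have hd : ∀ x ∈ Set.Ico q 1, HasDerivAt (dpdLoss β q) ((x - q) * lossWeight β x) x :=
    fun x hx => hasDerivAt_dpdLoss hβ q ⟨hq.trans_le hx.1, hx.2⟩
  refine strictMonoOn_of_deriv_pos (convex_Ico q 1)
    (fun x hx => (hd x hx).continuousAt.continuousWithinAt) fun x hx => ?_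
  rw [interior_Ico] at hx
  rw [(hd x ⟨hx.1.le, hx.2⟩).deriv]
  exact mul_pos (sub_pos.2 hx.1) (lossWeight_pos β ⟨hq.trans hx.1, hx.2⟩)

theorem dpdLoss_self_lt {β : ℝ} (hβ : 0 ≤ β) {q p : ℝ} (hq : q ∈ Set.Ioo (0 : ℝ) 1)
    (hp : p ∈ Set.Ioo (0 : ℝ) 1) (hne : p ≠ q) : dpdLoss β q q < dpdLoss β q p := by
  rcases lt_or_gt_of_ne hne with h | h
  · exact strictAntiOn_dpdLoss hβ hq.2 ⟨hp.1, h.le⟩ ⟨hq.1, le_rfl⟩ h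
  · exact strictMonoOn_dpdLoss hβ hq.1 ⟨le_rfl, hq.2⟩ ⟨h.le, hp.2⟩ h

theorem dpdLoss_self_le {β : ℝ} (hβ : 0 ≤ β) {q p : ℝ} (hq : q ∈ Set.Ioo (0 : ℝ) 1)
    (hp : p ∈ Set.Ioo (0 : ℝ) 1) : dpdLoss β q q ≤ dpdLoss β q p := by
  rcases eq_or_ne p q with rfl | h
  · exact le_rfl
  · exact (dpdLoss_self_lt hβ hq hp h).le

/-! ### Reduction of the criterion to a sum of cell losses -/

theorem failProb_mem_Ioo (w : ℝ) {t : ℝ} (ht : 0 < t) {α : Param} (hα : α ∈ paramSpace) :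
    failProb w t α ∈ Set.Ioo (0 : ℝ) 1 := by
  have h0 : 0 < α 0 := hα
  have h : 0 < rate w α * t := by unfold rate; positivity
  have h1 : Real.exp (-rate w α * t) < 1 := Real.exp_lt_one_iff.2 (by linarith)
  have h2 := Real.exp_pos (-rate w α * t)
  refine ⟨?_, ?_⟩
  · simp only [failProb, expF]; linarith
  · simp only [failProb, expF]; linarith

theorem V_eq {β : ℝ} (hβ : 0 < β) (p : ℝ) {y : ℕ} (hy : y = 0 ∨ y = 1) :
    V β p y = (1 + β) * (lossA β p - y * lossB β p) := by
  have hβ1 : 1 + β ≠ 0 := by positivity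
  rcases hy with rfl | rfl
  all_goals
    simp [V, lossA, lossB, hβ.ne']
    field_simp
    try ring

theorem mul_log_div_eq (q : ℝ) {p : ℝ} (hp : p ≠ 0) :
    q * Real.log (q / p) = q * Real.log q - q * Real.log p := by
  rcases eq_or_ne q 0 with rfl | hq
  · simp
  · rw [Real.log_div hq hp]; ring

/-- The criterion is an increasing affine function of the sum over the cells of the losses. -/
theorem criterion_eq {I J : ℕ} {β : ℝ} (hβ : 0 ≤ β) (w : Fin I → ℝ) {t : Fin J → ℝ}
    (ht : ∀ j, 0 < t j) {K : ℕ} (hK : 0 < K) {y : Fin I → Fin J → ℕ → ℕ}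
    (hy : ∀ i j k, y i j k = 0 ∨ y i j k = 1) :
    ∃ C : ℝ, ∀ α ∈ paramSpace, criterion β w t K y α =
      C + (1 + β) / ((I : ℝ) * J) * ∑ x : Fin I × Fin J,
        dpdLoss β ((failures y K x.1 x.2 : ℝ) / K) (failProb (w x.1) (t x.2) α) := by
  have hK' : (K : ℝ) ≠ 0 := by positivity
  simp_rw [Fintype.sum_prod_type]
  rcases hβ.eq_or_lt with rfl | hβ
  · refine ⟨1 / ((I : ℝ) * J) * ∑ i, ∑ j,
      ((failures y K i j : ℝ) / K * Real.log ((failures y K i j : ℝ) / K) +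
       (1 - (failures y K i j : ℝ) / K) * Real.log (1 - (failures y K i j : ℝ) / K)),
      fun α hα => ?_⟩
    rw [criterion, if_pos rfl, klDivergence, add_zero, ← mul_add, ← Finset.sum_add_distrib]
    simp_rw [← Finset.sum_add_distrib]
    congr 1
    refine Finset.sum_congr rfl fun i _ => Finset.sum_congr rfl fun j _ => ?_
    have hp := failProb_mem_Ioo (w i) (ht j) hα
    have e1 : ((K : ℝ) - failures y K i j) / K = 1 - (failures y K i j : ℝ) / K := by
      field_simp
    rw [← div_div, ← div_div, e1, mul_log_div_eq _ hp.1.ne',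
      mul_log_div_eq _ (sub_pos.2 hp.2).ne']
    simp only [dpdLoss, lossA, lossB, if_true]
    ring
  · refine ⟨0, fun α hα => ?_⟩
    rw [criterion, if_neg hβ.ne', zero_add]
    have e : ∀ i j, ∑ k ∈ Finset.range K, V β (failProb (w i) (t j) α) (y i j k) =
        (1 + β) * K * dpdLoss β ((failures y K i j : ℝ) / K) (failProb (w i) (t j) α) := by
      intro i j
      simp_rw [V_eq hβ _ (hy i j _), ← Finset.mul_sum, Finset.sum_sub_distrib, ← Finset.sum_mul]
      simp only [Finset.sum_const, Finset.card_range, nsmul_eq_mul, failures, dpdLoss,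
        Nat.cast_sum]
      field_simp
    simp_rw [e, ← Finset.mul_sum]
    rw [← mul_assoc]
    congr 1
    rw [one_div, mul_inv, div_eq_mul_inv]
    field_simp

theorem isMDPDE_iff {I J : ℕ} (hI : 0 < I) (hJ : 0 < J) {β : ℝ} (hβ : 0 ≤ β) (w : Fin I → ℝ)
    {t : Fin J → ℝ} (ht : ∀ j, 0 < t j) {K : ℕ} (hK : 0 < K) {y : Fin I → Fin J → ℕ → ℕ}
    (hy : ∀ i j k, y i j k = 0 ∨ y i j k = 1) (a : Param) :
    IsMDPDE β w t K y a ↔ a ∈ paramSpace ∧ IsMinOn (fun α => ∑ x : Fin I × Fin J,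
        dpdLoss β ((failures y K x.1 x.2 : ℝ) / K) (failProb (w x.1) (t x.2) α))
        paramSpace a := by
  obtain ⟨C, hC⟩ := criterion_eq hβ w ht hK hy
  have hc : 0 < (1 + β) / ((I : ℝ) * J) := by positivity
  refine and_congr_right fun ha => ?_
  simp only [isMinOn_iff]
  refine forall₂_congr fun α hα => ?_
  rw [hC a ha, hC α hα, add_le_add_iff_left, mul_le_mul_iff_right₀ hc]

/-! ### Gradient and inversion of the failure probabilities -/

theorem isOpen_paramSpace : IsOpen paramSpace :=
  isOpen_lt continuous_const (by fun_prop)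

/-- Gradient of `α ↦ failProb w t α`. -/
noncomputable def failGrad (w t : ℝ) (α : Param) : Param :=
  (t * expf t (rate w α)) • !₂[1 / α 0, w]

theorem continuous_rate (w : ℝ) : Continuous (rate w) := by unfold rate; fun_prop

theorem continuous_failProb (w t : ℝ) : Continuous (failProb w t) := by
  have := continuous_rate w
  unfold failProb expF; fun_prop

theorem continuousAt_failGrad (w t : ℝ) {α : Param} (hα : α ∈ paramSpace) :
    ContinuousAt (failGrad w t) α := by
  have h0 : α 0 ≠ 0 := ne_of_gt hα
  have := continuous_rate w
  have h1 : Continuous fun α => t * expf t (rate w α) := by unfold expf; fun_prop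
  refine h1.continuousAt.smul ?_
  refine (PiLp.continuous_toLp 2 _).continuousAt.comp (continuousAt_pi.2 fun i => ?_)
  fin_cases i
  · exact continuousAt_const.div (by fun_prop) h0
  · exact continuousAt_const

theorem hasFDerivAt_failProb (w t : ℝ) {α : Param} (hα : α ∈ paramSpace) :
    HasFDerivAt (failProb w t) (innerSL ℝ (failGrad w t α)) α := by
  have h0 : α 0 ≠ 0 := ne_of_gt hα
  have hc : ∀ i : Fin 2, HasFDerivAt (fun α : Param => α i)
      (EuclideanSpace.proj i : Param →L[ℝ] ℝ) α := fun i =>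
    (EuclideanSpace.proj i : Param →L[ℝ] ℝ).hasFDerivAt
  have h := ((((hc 0).mul ((hc 1).mul_const w).exp).neg.mul_const t).exp).const_sub 1
  refine h.congr_fderiv ?_
  ext v
  simp [failGrad, expf, rate, PiLp.inner_apply, Fin.sum_univ_two]
  field_simp
  ring

/-- The parameter recovered from the failure probabilities of two cells. -/
noncomputable def paramOfProbs (w₁ w₂ t₁ t₂ : ℝ) (p : ℝ × ℝ) : Param :=
  let l₁ := Real.log (-Real.log (1 - p.1) / t₁)
  let l₂ := Real.log (-Real.log (1 - p.2) / t₂)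
  !₂[Real.exp (l₁ - (l₁ - l₂) / (w₁ - w₂) * w₁), (l₁ - l₂) / (w₁ - w₂)]

theorem neg_log_one_sub_failProb_div (w : ℝ) {t : ℝ} (ht : 0 < t) (α : Param) :
    -Real.log (1 - failProb w t α) / t = rate w α := by
  have := ht.ne'
  rw [failProb, expF, sub_sub_cancel, Real.log_exp]
  field_simp

/-- The log-rate is affine in the temperature, with slope `α 1` and intercept `log (α 0)`, so its
values at two temperatures determine both. -/
theorem paramOfProbs_failProb {w₁ w₂ t₁ t₂ : ℝ} (hw : w₁ ≠ w₂) (h₁ : 0 < t₁) (h₂ : 0 < t₂)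
    {α : Param} (hα : α ∈ paramSpace) :
    paramOfProbs w₁ w₂ t₁ t₂ (failProb w₁ t₁ α, failProb w₂ t₂ α) = α := by
  have h0 : 0 < α 0 := hα
  have hw' : w₁ - w₂ ≠ 0 := sub_ne_zero.2 hw
  have hl : ∀ w, Real.log (rate w α) = Real.log (α 0) + α 1 * w := fun w => by
    rw [rate, Real.log_mul h0.ne' (Real.exp_pos _).ne', Real.log_exp]
  simp only [paramOfProbs, neg_log_one_sub_failProb_div _ h₁, neg_log_one_sub_failProb_div _ h₂, hl]
  have e : (Real.log (α 0) + α 1 * w₁ - (Real.log (α 0) + α 1 * w₂)) / (w₁ - w₂) = α 1 := by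
    field_simp; ring
  rw [e]
  ext i
  fin_cases i
  · simp [Real.exp_log h0]
  · simp

theorem continuousAt_paramOfProbs (w₁ w₂ : ℝ) {t₁ t₂ : ℝ} (h₁ : 0 < t₁) (h₂ : 0 < t₂)
    {p : ℝ × ℝ} (hp₁ : p.1 ∈ Set.Ioo (0 : ℝ) 1) (hp₂ : p.2 ∈ Set.Ioo (0 : ℝ) 1) :
    ContinuousAt (paramOfProbs w₁ w₂ t₁ t₂) p := by
  have aux : ∀ {f : ℝ × ℝ → ℝ} {t : ℝ}, 0 < t → ContinuousAt f p → f p ∈ Set.Ioo (0 : ℝ) 1 →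
      ContinuousAt (fun p => Real.log (-Real.log (1 - f p) / t)) p := by
    intro f t ht hf hfp
    have h1 : 0 < 1 - f p := sub_pos.2 hfp.2
    have h2 : Real.log (1 - f p) < 0 := Real.log_neg h1 (by linarith [hfp.1])
    refine ((((continuousAt_const.sub hf).log h1.ne').neg).div_const t).log ?_
    exact (div_pos (neg_pos.2 h2) ht).ne'
  have c₁ := aux h₁ continuousAt_fst hp₁
  have c₂ := aux h₂ continuousAt_snd hp₂
  refine (PiLp.continuous_toLp 2 _).continuousAt.comp (continuousAt_pi.2 fun i => ?_)
  have c₃ := (c₁.sub c₂).div_const (w₁ - w₂)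
  fin_cases i
  · exact (c₁.sub (c₃.mul_const w₁)).rexp
  · exact c₃

/-! ### Identifiability and the score equation -/

section Cells

variable {ι : Type*} {w t : ι → ℝ}

/-- Parameters are identified, continuously, by the failure probabilities. -/
theorem exists_forall_abs_failProb_sub_lt (ht : ∀ x, 0 < t x) (hw : ∃ x x', w x ≠ w x')
    {α₀ : Param} (hα₀ : α₀ ∈ paramSpace) {U : Set Param} (hU : U ∈ 𝓝 α₀) :
    ∃ ρ > 0, ∀ α ∈ paramSpace,
      (∀ x, |failProb (w x) (t x) α - failProb (w x) (t x) α₀| < ρ) → α ∈ U := by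
  obtain ⟨x, x', hx⟩ := hw
  have hc := continuousAt_paramOfProbs (w x) (w x') (ht x) (ht x')
    (p := (failProb (w x) (t x) α₀, failProb (w x') (t x') α₀))
    (failProb_mem_Ioo _ (ht x) hα₀) (failProb_mem_Ioo _ (ht x') hα₀)
  have hU' := hc.eventually (by rwa [paramOfProbs_failProb hx (ht x) (ht x') hα₀] :
    ∀ᶠ a in 𝓝 _, a ∈ U)
  obtain ⟨ρ, hρ, h⟩ := Metric.eventually_nhds_iff.1 hU'
  refine ⟨ρ, hρ, fun α hα hd => ?_⟩
  have := @h (failProb (w x) (t x) α, failProb (w x') (t x') α) (by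
    rw [Prod.dist_eq, max_lt_iff]
    exact ⟨hd x, hd x'⟩)
  rwa [paramOfProbs_failProb hx (ht x) (ht x') hα] at this

variable [Fintype ι]

/-- Sum over the cells of the losses of the observed frequencies `q` against the model. -/
noncomputable def totalLoss (β : ℝ) (w t : ι → ℝ) (q : ι → ℝ) (α : Param) : ℝ :=
  ∑ x, dpdLoss β (q x) (failProb (w x) (t x) α)

theorem hasFDerivAt_totalLoss {β : ℝ} (hβ : 0 ≤ β) (ht : ∀ x, 0 < t x) (q : ι → ℝ) {α : Param}
    (hα : α ∈ paramSpace) :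
    HasFDerivAt (totalLoss β w t q) (innerSL ℝ (∑ x, (failProb (w x) (t x) α - q x) •
      lossWeight β (failProb (w x) (t x) α) • failGrad (w x) (t x) α)) α := by
  rw [map_sum]
  refine HasFDerivAt.fun_sum fun x _ => ?_
  refine ((hasDerivAt_dpdLoss hβ (q x) (failProb_mem_Ioo (w x) (ht x) hα)).comp_hasFDerivAt α
    (hasFDerivAt_failProb (w x) (t x) hα)).congr_fderiv ?_
  rw [map_smul, map_smul, smul_smul]

/-- The parameter space is open, so a minimiser is a critical point. -/
theorem score_eq_zero {β : ℝ} (hβ : 0 ≤ β) (ht : ∀ x, 0 < t x) {q : ι → ℝ} {a : Param}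
    (ha : a ∈ paramSpace) (hmin : IsMinOn (totalLoss β w t q) paramSpace a) :
    ∑ x, (failProb (w x) (t x) a - q x) •
      lossWeight β (failProb (w x) (t x) a) • failGrad (w x) (t x) a = 0 := by
  have h := (hmin.isLocalMin (isOpen_paramSpace.mem_nhds ha)).hasFDerivAt_eq_zero
    (hasFDerivAt_totalLoss hβ ht q ha)
  rw [← inner_self_eq_zero (𝕜 := ℝ), ← innerSL_apply_apply ℝ, h]
  rfl

end Cells

/-! ### Existence, consistency and linearisation of minimisers -/

section Deterministic

variable {ι : Type*} [Fintype ι] {w t : ι → ℝ}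

theorem continuousAt_dpdLoss_self {β : ℝ} (hβ : 0 ≤ β) {p : ℝ} (hp : p ∈ Set.Ioo (0 : ℝ) 1) :
    ContinuousAt (fun q => dpdLoss β q q) p :=
  (hasDerivAt_lossA hβ hp).continuousAt.sub
    (continuousAt_id.mul (hasDerivAt_lossB hp).continuousAt)

theorem continuous_dpdLoss_left (β p : ℝ) : Continuous fun q => dpdLoss β q p := by
  unfold dpdLoss; fun_prop

/-- Supplies the margin for consistency: the losses will be compared at `p x ± r`, which must be
genuine probabilities. -/
theorem exists_pos_lt_forall_add_mem_Ioo {p : ι → ℝ} (hp : ∀ x, p x ∈ Set.Ioo (0 : ℝ) 1) {ρ : ℝ}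
    (hρ : 0 < ρ) :
    ∃ r > 0, r < ρ ∧ ∀ x, p x - r ∈ Set.Ioo (0 : ℝ) 1 ∧ p x + r ∈ Set.Ioo (0 : ℝ) 1 := by
  have h : ∀ᶠ r in 𝓝 (0 : ℝ), r < ρ ∧
      ∀ x, p x - r ∈ Set.Ioo (0 : ℝ) 1 ∧ p x + r ∈ Set.Ioo (0 : ℝ) 1 := by
    refine (eventually_lt_nhds hρ).and (eventually_all.2 fun x => ?_)
    have h1 : Tendsto (fun r : ℝ => p x - r) (𝓝 0) (𝓝 (p x)) := by
      simpa using (tendsto_const_nhds (x := p x)).sub (tendsto_id (x := 𝓝 (0 : ℝ)))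
    have h2 : Tendsto (fun r : ℝ => p x + r) (𝓝 0) (𝓝 (p x)) := by
      simpa using (tendsto_const_nhds (x := p x)).add (tendsto_id (x := 𝓝 (0 : ℝ)))
    exact (h1.eventually (isOpen_Ioo.mem_nhds (hp x))).and
      (h2.eventually (isOpen_Ioo.mem_nhds (hp x)))
  obtain ⟨r, hr⟩ := ((h.filter_mono nhdsWithin_le_nhds).and
    (self_mem_nhdsWithin : Set.Ioi (0 : ℝ) ∈ 𝓝[>] 0)).exists
  exact ⟨r, hr.2, hr.1⟩

/-- Outside a neighbourhood of `α₀` the total loss exceeds its value at `α₀`, if the observed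
frequencies are close to the failure probabilities under `α₀`. -/
theorem eventually_forall_totalLoss_lt {β : ℝ} (hβ : 0 ≤ β) (ht : ∀ x, 0 < t x)
    (hw : ∃ x x', w x ≠ w x') {α₀ : Param} (hα₀ : α₀ ∈ paramSpace) {U : Set Param}
    (hU : U ∈ 𝓝 α₀) :
    ∀ᶠ q in 𝓝 (fun x => failProb (w x) (t x) α₀), ∀ α ∈ paramSpace, α ∉ U →
      totalLoss β w t q α₀ < totalLoss β w t q α := by
  set p : ι → ℝ := fun x => failProb (w x) (t x) α₀ with hp_def
  have hp : ∀ x, p x ∈ Set.Ioo (0 : ℝ) 1 := fun x => failProb_mem_Ioo _ (ht x) hα₀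
  obtain ⟨ρ', hρ', hid⟩ := exists_forall_abs_failProb_sub_lt ht hw hα₀ hU
  obtain ⟨ρ, hρ, hρρ, hmem⟩ := exists_pos_lt_forall_add_mem_Ioo hp hρ'
  have hq : ∀ x, Tendsto (fun q : ι → ℝ => q x) (𝓝 p) (𝓝 (p x)) := fun x =>
    (continuous_apply x).tendsto p
  have hself : ∀ x, Tendsto (fun q : ι → ℝ => dpdLoss β (q x) (q x)) (𝓝 p)
      (𝓝 (dpdLoss β (p x) (p x))) := fun x =>
    (continuousAt_dpdLoss_self hβ (hp x)).tendsto.comp (hq x)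
  have hleft : ∀ x c, Tendsto (fun q : ι → ℝ => dpdLoss β (q x) c) (𝓝 p)
      (𝓝 (dpdLoss β (p x) c)) := fun x c =>
    ((continuous_dpdLoss_left β c).tendsto _).comp (hq x)
  -- Minus the excess of the total loss at `α₀` over its cellwise lower bound; it vanishes in the
  -- limit, while the gap at `p x ± ρ` does not.
  let e : (ι → ℝ) → ℝ := fun q => ∑ x, (dpdLoss β (q x) (q x) - dpdLoss β (q x) (p x))
  have he : Tendsto e (𝓝 p) (𝓝 0) := by
    have := tendsto_finsetSum Finset.univ fun x _ => (hself x).sub (hleft x (p x))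
    simpa only [sub_self, Finset.sum_const_zero] using this
  have hgap : ∀ x c, c ∈ Set.Ioo (0 : ℝ) 1 → c ≠ p x →
      ∀ᶠ q in 𝓝 p, 0 < e q + (dpdLoss β (q x) c - dpdLoss β (q x) (q x)) := by
    intro x c hc hne
    have := he.add ((hleft x c).sub (hself x))
    refine this.eventually_const_lt ?_
    rw [zero_add, sub_pos]
    exact dpdLoss_self_lt hβ (hp x) hc hne
  filter_upwards [eventually_all.2 fun x => hgap x (p x - ρ) (hmem x).1 (by linarith),
    eventually_all.2 fun x => hgap x (p x + ρ) (hmem x).2 (by linarith),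
    eventually_all.2 fun x => (hq x).eventually (isOpen_Ioo.mem_nhds (hp x)),
    eventually_all.2 fun x => (hq x).eventually
      (Ioo_mem_nhds (sub_lt_self (p x) hρ) (lt_add_of_pos_right (p x) hρ))]
    with q h1 h2 hq01 hqp α hα hαU
  have hpα : ∀ x, failProb (w x) (t x) α ∈ Set.Ioo (0 : ℝ) 1 :=
    fun x => failProb_mem_Ioo _ (ht x) hα
  obtain ⟨x, hx⟩ : ∃ x, ρ' ≤ |failProb (w x) (t x) α - p x| := by
    by_contra! h
    exact hαU (hid α hα h)
  -- Monotonicity on either side of `q x` carries the gap from `p x ± ρ` to every probability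
  -- further out, which makes the bound uniform over the non-compact set of `α`.
  have hcell : 0 < e q +
      (dpdLoss β (q x) (failProb (w x) (t x) α) - dpdLoss β (q x) (q x)) := by
    rcases le_abs'.1 (hρρ.le.trans hx) with h | h
    · have := (strictAntiOn_dpdLoss hβ (hq01 x).2).antitoneOn
        ⟨(hpα x).1, by linarith [(hqp x).1]⟩ ⟨(hmem x).1.1, (hqp x).1.le⟩
        (by linarith : failProb (w x) (t x) α ≤ p x - ρ)
      linarith [h1 x]
    · have := (strictMonoOn_dpdLoss hβ (hq01 x).1).monotoneOn
        ⟨(hqp x).2.le, (hmem x).2.2⟩ ⟨by linarith [(hqp x).2], (hpα x).2⟩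
        (by linarith : p x + ρ ≤ failProb (w x) (t x) α)
      linarith [h2 x]
  have hsum := Finset.single_le_sum
    (f := fun x => dpdLoss β (q x) (failProb (w x) (t x) α) - dpdLoss β (q x) (q x))
    (fun x _ => sub_nonneg.2 (dpdLoss_self_le hβ (hq01 x) (hpα x))) (Finset.mem_univ x)
  have hdecomp : totalLoss β w t q α - totalLoss β w t q α₀ = e q +
      ∑ x, (dpdLoss β (q x) (failProb (w x) (t x) α) - dpdLoss β (q x) (q x)) := by
    simp only [totalLoss, e, ← Finset.sum_sub_distrib, ← Finset.sum_add_distrib]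
    exact Finset.sum_congr rfl fun x _ => by simp only [hp_def]; ring
  linarith

/-- Existence and consistency of the minimisers of the total loss. -/
theorem eventually_exists_isMinOn_totalLoss {β : ℝ} (hβ : 0 ≤ β) (ht : ∀ x, 0 < t x)
    (hw : ∃ x x', w x ≠ w x') {α₀ : Param} (hα₀ : α₀ ∈ paramSpace) {U : Set Param}
    (hU : U ∈ 𝓝 α₀) :
    ∀ᶠ q in 𝓝 (fun x => failProb (w x) (t x) α₀),
      (∃ a ∈ paramSpace, IsMinOn (totalLoss β w t q) paramSpace a) ∧
      ∀ a ∈ paramSpace, IsMinOn (totalLoss β w t q) paramSpace a → a ∈ U := by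
  obtain ⟨r, hr, hrU⟩ := Metric.nhds_basis_closedBall.mem_iff.1
    (inter_mem hU (isOpen_paramSpace.mem_nhds hα₀))
  filter_upwards [eventually_forall_totalLoss_lt hβ ht hw hα₀ (Metric.closedBall_mem_nhds α₀ hr)]
    with q hq
  have hc : ContinuousOn (totalLoss β w t q) (Metric.closedBall α₀ r) := fun a ha =>
    (hasFDerivAt_totalLoss hβ ht q (hrU ha).2).continuousAt.continuousWithinAt
  have hmem : α₀ ∈ Metric.closedBall α₀ r := Metric.mem_closedBall_self hr.le
  refine ⟨?_, fun a ha hmin => ?_⟩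
  · obtain ⟨a, ha, hmin⟩ := (isCompact_closedBall α₀ r).exists_isMinOn ⟨α₀, hmem⟩ hc
    refine ⟨a, (hrU ha).2, fun α hα => ?_⟩
    -- Outside the ball `α₀` already does better, so the minimiser on the ball is global.
    by_cases h : α ∈ Metric.closedBall α₀ r
    · exact hmin h
    · exact (hmin hmem).trans (hq α hα h).le
  · by_contra h
    have h' : a ∉ Metric.closedBall α₀ r := fun h' => h (hrU h').1
    exact (hq a ha h').not_ge (hmin hα₀)

open Asymptotics in
/-- Minimisers of the total loss are asymptotically linear in the observed frequencies. -/
theorem eventually_norm_isMinOn_totalLoss_sub_le {β : ℝ} (hβ : 0 ≤ β) (ht : ∀ x, 0 < t x)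
    (hw : ∃ x x', w x ≠ w x') {α₀ : Param} (hα₀ : α₀ ∈ paramSpace) (A : Param →L[ℝ] Param)
    (hA : ∀ v, A (∑ x, inner ℝ (failGrad (w x) (t x) α₀) v •
      lossWeight β (failProb (w x) (t x) α₀) • failGrad (w x) (t x) α₀) = v)
    {ε : ℝ} (hε : 0 < ε) :
    ∀ᶠ q in 𝓝 (fun x => failProb (w x) (t x) α₀),
      ∀ a ∈ paramSpace, IsMinOn (totalLoss β w t q) paramSpace a →
      ‖a - α₀ - ∑ x, (q x - failProb (w x) (t x) α₀) •
        A (lossWeight β (failProb (w x) (t x) α₀) • failGrad (w x) (t x) α₀)‖ ≤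
      ε * ‖q - fun x => failProb (w x) (t x) α₀‖ := by
  set p : ι → ℝ := fun x => failProb (w x) (t x) α₀ with hp_def
  let g : ι → Param → Param := fun x α =>
    lossWeight β (failProb (w x) (t x) α) • failGrad (w x) (t x) α
  -- Along this filter `q` tends to `p` and the second component is any minimiser for `q`; little-o
  -- along it is therefore uniform over minimisers.
  let l : Filter ((ι → ℝ) × Param) := comap Prod.fst (𝓝 p) ⊓
    𝓟 {z | z.2 ∈ paramSpace ∧ IsMinOn (totalLoss β w t z.1) paramSpace z.2}
  let δ : (ι → ℝ) × Param → ι → ℝ := fun z => z.1 - p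
  let h : (ι → ℝ) × Param → Param := fun z => z.2 - α₀
  let N : (ι → ℝ) × Param → ℝ := fun z => ‖h z‖ + ‖δ z‖
  have hsnd : Tendsto Prod.snd l (𝓝 α₀) := by
    intro U hU
    rw [mem_map]
    have := eventually_exists_isMinOn_totalLoss hβ ht hw hα₀ hU
    refine eventually_inf_principal.2 (eventually_comap.2 ?_)
    filter_upwards [this] with q hq z hz hzm
    subst hz
    exact hq.2 z.2 hzm.1 hzm.2
  have hhN : h =O[l] N := isBigO_of_le _ fun z => by
    rw [Real.norm_of_nonneg (by positivity)]
    exact le_add_of_nonneg_right (norm_nonneg _)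
  have hδN : δ =O[l] N := isBigO_of_le _ fun z => by
    rw [Real.norm_of_nonneg (by positivity)]
    exact le_add_of_nonneg_left (norm_nonneg _)
  have hδx : ∀ x, (fun z => δ z x) =O[l] N := fun x =>
    (isBigO_of_le l fun z => norm_le_pi_norm (δ z) x).trans hδN
  have hg : ∀ x, Tendsto (fun z : (ι → ℝ) × Param => g x z.2) l (𝓝 (g x α₀)) := fun x => by
    have hc : ContinuousAt (g x) α₀ :=
      (ContinuousAt.comp (continuousAt_lossWeight β (failProb_mem_Ioo (w x) (ht x) hα₀))
        (continuous_failProb (w x) (t x)).continuousAt).smul (continuousAt_failGrad _ _ hα₀)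
    exact hc.tendsto.comp hsnd
  let u : ι → (ι → ℝ) × Param → ℝ := fun x z => inner ℝ (failGrad (w x) (t x) α₀) (h z)
  have hu : ∀ x, u x =O[l] N := fun x =>
    ((innerSL ℝ (failGrad (w x) (t x) α₀)).isBigO_comp h l).trans hhN
  have hpu : ∀ x, (fun z : (ι → ℝ) × Param => failProb (w x) (t x) z.2 - p x - u x z) =o[l] N :=
    fun x => ((hasFDerivAt_failProb (w x) (t x) hα₀).isLittleO.comp_tendsto hsnd).trans_isBigO hhN
  -- The error of replacing, in the score, the probability increment by its differential and the
  -- weighted gradient by its value at `α₀`.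
  have hE : (fun z : (ι → ℝ) × Param => ∑ x, ((failProb (w x) (t x) z.2 - p x - u x z) • g x z.2 +
      (u x z - δ z x) • (g x z.2 - g x α₀))) =o[l] N := by
    refine IsLittleO.fun_sum fun x _ => IsLittleO.add ?_ ?_
    · simpa using (hpu x).smul_isBigO ((hg x).isBigO_one ℝ)
    · have h0 : (fun z : (ι → ℝ) × Param => g x z.2 - g x α₀) =o[l] fun _ => (1 : ℝ) := by
        rw [isLittleO_one_iff]
        simpa using (hg x).sub_const (g x α₀)
      simpa using ((hu x).sub (hδx x)).smul_isLittleO h0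
  let L : (ι → ℝ) × Param → Param := fun z => ∑ x, δ z x • A (g x α₀)
  have hlin : (fun z => h z - L z) =o[l] N := by
    refine ((A.isBigO_comp _ l).trans_isLittleO hE).neg_left.congr' ?_ EventuallyEq.rfl
    refine eventually_inf_principal.2 (Eventually.of_forall fun z hz => ?_)
    have hs := score_eq_zero hβ ht hz.1 hz.2
    have e1 : ∑ x, ((failProb (w x) (t x) z.2 - p x - u x z) • g x z.2 +
        (u x z - δ z x) • (g x z.2 - g x α₀)) =
        ∑ x, δ z x • g x α₀ - ∑ x, u x z • g x α₀ := by
      -- The two sides differ exactly by the score, which is zero.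
      rw [← Finset.sum_sub_distrib, ← sub_eq_zero, ← Finset.sum_sub_distrib, ← hs]
      refine Finset.sum_congr rfl fun x _ => ?_
      simp only [δ, Pi.sub_apply, g]
      module
    show -A _ = _
    rw [e1, map_sub, hA (h z), map_sum]
    simp only [map_smul, neg_sub, L]
  have hL : L =O[l] δ := by
    refine IsBigO.fun_sum fun x _ => ?_
    have h1 : (fun z => δ z x) =O[l] δ := isBigO_of_le l fun z => norm_le_pi_norm (δ z) x
    have h2 : (fun _ => A (g x α₀)) =O[l] fun _ : (ι → ℝ) × Param => (1 : ℝ) :=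
      isBigO_const_const _ one_ne_zero _
    simpa using h1.norm_right.smul h2
  have hhδ : h =O[l] δ := by
    obtain ⟨C, hC⟩ := hL.bound
    -- From `‖h‖ ≤ ‖L‖ + (‖h‖ + ‖δ‖) / 2` and `‖L‖ ≤ C * ‖δ‖`, absorbing `‖h‖ / 2` on the left.
    refine IsBigO.of_bound (2 * C + 1) ?_
    filter_upwards [hC, hlin.def (half_pos one_pos)] with z h1 h2
    have h3 := norm_le_norm_add_norm_sub' (h z) (L z)
    rw [Real.norm_of_nonneg (by positivity : 0 ≤ N z)] at h2
    simp only [N] at h2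
    linarith
  have hNδ : N =O[l] δ := hhδ.norm_left.add (isBigO_refl δ l).norm_left
  have hfin := (hlin.trans_isBigO hNδ).def hε
  have := eventually_comap.1 (eventually_inf_principal.1 hfin)
  filter_upwards [this] with q hq a ha hmin
  exact hq (q, a) rfl ⟨ha, hmin⟩

end Deterministic

/-! ### Central limit theorem, Chebyshev bound and negligible remainders -/

section Limit

variable {Ω : Type*} [MeasurableSpace Ω] {P : Measure Ω}

/-- The law of a sum over a finite array of independent variables: its characteristic function is
the product of the characteristic functions of the sums of the rows. -/
theorem charFun_map_sum_rows {ι : Type*} [Fintype ι] {X : ι → ℕ → Ω → ℝ}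
    (hX : ∀ x k, AEMeasurable (X x k) P) (hindep : iIndepFun (fun z : ι × ℕ => X z.1 z.2) P)
    (n : ℕ) (u : ℝ) :
    charFun (P.map fun ω => ∑ x, ∑ k ∈ Finset.range n, X x k ω) u =
      ∏ x, charFun (P.map fun ω => ∑ k ∈ Finset.range n, X x k ω) u := by
  have h1 : (fun ω => ∑ x, ∑ k ∈ Finset.range n, X x k ω) =
      fun ω => ∑ z ∈ Finset.univ ×ˢ Finset.range n, X z.1 z.2 ω := by
    funext ω; rw [Finset.sum_product]
  rw [h1, iIndepFun.charFun_map_fun_finsetSum_eq_prod (X := fun z : ι × ℕ => X z.1 z.2)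
    (fun z _ => hX z.1 z.2) (hindep.restrict _), Finset.prod_apply, Finset.prod_product]
  refine Finset.prod_congr rfl fun x _ => ?_
  have hrow : iIndepFun (X x) P := hindep.precomp (g := fun k : ℕ => (x, k)) fun _ _ h => by
    simpa using h
  rw [iIndepFun.charFun_map_fun_finsetSum_eq_prod (fun k _ => hX x k) (hrow.restrict _),
    Finset.prod_apply]

variable [IsProbabilityMeasure P]

open scoped RealInnerProductSpace in
/-- A multivariate central limit theorem for linear combinations of the normalised row sums of an
array of independent variables which are identically distributed along the rows. -/
theorem tendstoInDistribution_sum_smul_rows {ι κ : Type*} [Fintype ι] [Fintype κ] [DecidableEq κ]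
    {X : ι → ℕ → Ω → ℝ} (hindep : iIndepFun (fun z : ι × ℕ => X z.1 z.2) P)
    (hident : ∀ x k, IdentDistrib (X x k) (X x 0) P P) (hmem : ∀ x, MemLp (X x 0) 2 P)
    (c : ι → EuclideanSpace ℝ κ) {S : Matrix κ κ ℝ} (hS : S.PosSemidef)
    (hcov : ∀ s : EuclideanSpace ℝ κ,
      s.ofLp ⬝ᵥ S.mulVec s.ofLp = ∑ x, Var[X x 0; P] * ⟪c x, s⟫ ^ 2) :
    TendstoInDistribution (fun (n : ℕ) ω =>
      ∑ x, ((√n)⁻¹ * (∑ k ∈ Finset.range n, X x k ω - n * P[X x 0])) • c x) atTop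
      id (fun _ => P) (multivariateGaussian 0 S) := by
  have hX : ∀ x k, AEMeasurable (X x k) P := fun x k => (hident x k).aemeasurable_fst
  have hT : ∀ x (n : ℕ), AEMeasurable
      (fun ω => (√n)⁻¹ * (∑ k ∈ Finset.range n, X x k ω - n * P[X x 0])) P := fun x n =>
    ((Finset.aemeasurable_fun_sum _ fun k _ => hX x k).sub_const _).const_mul _
  have hW : ∀ n : ℕ, AEMeasurable (fun ω =>
      ∑ x, ((√n)⁻¹ * (∑ k ∈ Finset.range n, X x k ω - n * P[X x 0])) • c x) P := fun n =>
    Finset.aemeasurable_fun_sum _ fun x _ => (hT x n).smul_const (c x)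
  refine ⟨hW, aemeasurable_id, ProbabilityMeasure.tendsto_iff_tendsto_charFun.2 fun s => ?_⟩
  have hrow : ∀ x, iIndepFun (X x) P := fun x =>
    hindep.precomp (g := fun k : ℕ => (x, k)) fun _ _ h => by simpa using h
  have hlim : ∀ x, Tendsto (fun n : ℕ => charFun (P.map fun ω =>
      (√n)⁻¹ * (∑ k ∈ Finset.range n, X x k ω - n * P[X x 0])) ⟪c x, s⟫) atTop
      (𝓝 (charFun (gaussianReal 0 Var[X x 0; P].toNNReal) ⟪c x, s⟫)) := fun x => by
    have h := (tendstoInDistribution_inv_sqrt_mul_sum_sub (Y := id)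
      (P' := gaussianReal 0 Var[X x 0; P].toNNReal) HasLaw.id (hmem x) (hrow x)
      (hident x)).tendsto
    have h' := ProbabilityMeasure.tendsto_iff_tendsto_charFun.1 h ⟪c x, s⟫
    simpa using h'
  have hchar : ∀ n : ℕ, charFun (P.map fun ω =>
      ∑ x, ((√n)⁻¹ * (∑ k ∈ Finset.range n, X x k ω - n * P[X x 0])) • c x) s =
      ∏ x, charFun (P.map fun ω =>
        (√n)⁻¹ * (∑ k ∈ Finset.range n, X x k ω - n * P[X x 0])) ⟪c x, s⟫ := fun n => by
    -- Pairing with `s` makes the problem scalar: the rows of `Y` sum to the summands of the inner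
    -- product, whose characteristic function is taken at `1`.
    let Y : ι → ℕ → Ω → ℝ := fun x k ω => ⟪c x, s⟫ * ((√n)⁻¹ * (X x k ω - P[X x 0]))
    have hYm : ∀ x k, AEMeasurable (Y x k) P := fun x k =>
      (((hX x k).sub_const _).const_mul _).const_mul _
    have hYi : iIndepFun (fun z : ι × ℕ => Y z.1 z.2) P :=
      hindep.comp (fun z v => ⟪c z.1, s⟫ * ((√n)⁻¹ * (v - ∫ ω, X z.1 0 ω ∂P))) (by fun_prop)
    have hYsum : ∀ x ω, ∑ k ∈ Finset.range n, Y x k ω =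
        ⟪c x, s⟫ * ((√n)⁻¹ * (∑ k ∈ Finset.range n, X x k ω - n * P[X x 0])) := fun x ω => by
      simp only [Y]
      rw [← Finset.mul_sum, ← Finset.mul_sum, Finset.sum_sub_distrib]
      simp
    have hrows := charFun_map_sum_rows hYm hYi n 1
    simp only [hYsum] at hrows
    have hfac : ∀ x, charFun (P.map fun ω => ⟪c x, s⟫ *
        ((√n)⁻¹ * (∑ k ∈ Finset.range n, X x k ω - n * P[X x 0]))) 1 =
        charFun (P.map fun ω =>
          (√n)⁻¹ * (∑ k ∈ Finset.range n, X x k ω - n * P[X x 0])) ⟪c x, s⟫ := fun x => by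
      rw [charFun_map_mul_comp (hT x n), mul_one]
    simp only [hfac] at hrows
    rw [← hrows, charFun_apply, charFun_apply_real, integral_map (hW n) (by fun_prop),
      integral_map (Finset.aemeasurable_fun_sum _ fun x _ => (hT x n).const_mul _) (by fun_prop)]
    simp only [sum_inner, real_inner_smul_left, Complex.ofReal_one, one_mul]
    simp_rw [mul_comm]
  have hgauss : charFun ((multivariateGaussian 0 S).map id) s =
      ∏ x, charFun (gaussianReal 0 Var[X x 0; P].toNNReal) ⟪c x, s⟫ := by
    rw [Measure.map_id, charFun_multivariateGaussian hS, hcov s]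
    simp only [charFun_gaussianReal]
    rw [← Complex.exp_sum]
    congr 1
    simp only [inner_zero_right, Complex.ofReal_zero, zero_mul, mul_zero, zero_sub]
    push_cast
    rw [Finset.sum_neg_distrib, Finset.sum_div]
    simp_rw [Real.coe_toNNReal _ (variance_nonneg _ _)]
  simp only [ProbabilityMeasure.coe_mk, hchar, hgauss]
  exact tendsto_finsetProd _ fun x _ => hlim x

/-- If `Q` concentrates around `p` at rate `1 / √K` and `D` is, almost surely, negligible compared
to `Q - p` near `p`, then `√K • D` tends to zero in probability. -/
theorem tendstoInMeasure_sqrt_smul {E F : Type*} [NormedAddCommGroup E] [NormedSpace ℝ E]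
    [NormedAddCommGroup F] {Q : ℕ → Ω → F} {p : F} {D : ℕ → Ω → E} {C : ℝ} (hC : 0 ≤ C)
    (hQ : ∀ K : ℕ, 0 < K → ∀ r : ℝ, 0 < r → P.real {ω | r ≤ ‖Q K ω - p‖} ≤ C / (K * r ^ 2))
    (hD : ∀ ε : ℝ, 0 < ε → ∃ s ∈ 𝓝 p, ∀ K : ℕ, 0 < K → ∀ᵐ ω ∂P, Q K ω ∈ s →
      ‖D K ω‖ ≤ ε * ‖Q K ω - p‖) :
    TendstoInMeasure P (fun (K : ℕ) ω => √(K : ℝ) • D K ω) atTop 0 := by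
  rw [tendstoInMeasure_iff_measureReal_norm]
  intro ε hε
  rw [Metric.tendsto_nhds]
  intro η hη
  -- Chosen so that `C * (e / ε) ^ 2 ≤ η / 2`; the `C + 1` keeps the denominator positive when `C =
  -- 0`.
  set e : ℝ := ε * √(η / (2 * (C + 1))) with he_def
  have he : 0 < e := by positivity
  have hesq : C / (ε / e) ^ 2 ≤ η / 2 := by
    have h1 : e ^ 2 = ε ^ 2 * (η / (2 * (C + 1))) := by
      rw [he_def, mul_pow, Real.sq_sqrt (by positivity)]
    rw [div_pow, h1]
    field_simp
    nlinarith
  obtain ⟨s, hs, hDs⟩ := hD e he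
  obtain ⟨r, hr, hrs⟩ := Metric.mem_nhds_iff.1 hs
  have hlim : Tendsto (fun K : ℕ => C / (K * r ^ 2)) atTop (𝓝 0) :=
    tendsto_const_nhds.div_atTop (tendsto_natCast_atTop_atTop.atTop_mul_const (by positivity))
  filter_upwards [hlim.eventually_lt_const (half_pos hη), eventually_gt_atTop 0] with K hK hK0
  have hK0' : (0 : ℝ) < K := by exact_mod_cast hK0
  have hsub : {ω | ε ≤ ‖√(K : ℝ) • D K ω - (0 : Ω → E) ω‖} ≤ᵐ[P]
      ({ω | r ≤ ‖Q K ω - p‖} ∪ {ω | ε / (e * √K) ≤ ‖Q K ω - p‖} : Set Ω) := by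
    filter_upwards [hDs K hK0] with ω hω h
    by_cases hb : r ≤ ‖Q K ω - p‖
    · exact Or.inl hb
    · right
      have h1 := hω (hrs (by rw [Metric.mem_ball, dist_eq_norm]; exact not_le.1 hb))
      have h2 : ε ≤ √(K : ℝ) * ‖D K ω‖ := by
        have h3 : ε ≤ ‖√(K : ℝ) • D K ω - (0 : Ω → E) ω‖ := h
        rwa [Pi.zero_apply, sub_zero, norm_smul, Real.norm_of_nonneg (Real.sqrt_nonneg _)] at h3
      show ε / (e * √K) ≤ ‖Q K ω - p‖
      rw [div_le_iff₀ (by positivity)]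
      calc ε ≤ √(K : ℝ) * (e * ‖Q K ω - p‖) := h2.trans (by gcongr)
        _ = _ := by ring
  have hle : P.real {ω | ε ≤ ‖√(K : ℝ) • D K ω - (0 : Ω → E) ω‖} ≤
      C / (K * r ^ 2) + C / (K * (ε / (e * √K)) ^ 2) :=
    (ENNReal.toReal_mono (measure_ne_top _ _) (measure_mono_ae hsub)).trans
      ((measureReal_union_le _ _).trans
        (add_le_add (hQ K hK0 r hr) (hQ K hK0 _ (by positivity))))
  -- The factor `√K` in the threshold cancels the `K` of the concentration bound.
  have hsecond : C / (K * (ε / (e * √K)) ^ 2) = C / (ε / e) ^ 2 := by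
    congr 1
    rw [div_pow, div_pow, mul_pow, Real.sq_sqrt hK0'.le]
    field_simp
  rw [Real.dist_eq, sub_zero, abs_of_nonneg measureReal_nonneg]
  linarith

/-- Chebyshev's inequality for the empirical means of the rows of an array of independent variables
with variances at most one. -/
theorem measureReal_le_norm_mean_sub_le {ι : Type*} [Fintype ι] {X : ι → ℕ → Ω → ℝ}
    (hindep : iIndepFun (fun z : ι × ℕ => X z.1 z.2) P)
    (hmem : ∀ x k, MemLp (X x k) 2 P) {p : ι → ℝ} (hmean : ∀ x k, P[X x k] = p x)
    (hvar : ∀ x k, Var[X x k; P] ≤ 1) {K : ℕ} (hK : 0 < K) {r : ℝ} (hr : 0 < r) :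
    P.real {ω | r ≤ ‖(fun x => (∑ k ∈ Finset.range K, X x k ω) / (K : ℝ)) - p‖} ≤
      Fintype.card ι / (K * r ^ 2) := by
  have hK' : (0 : ℝ) < K := by exact_mod_cast hK
  have hsub : {ω | r ≤ ‖(fun x => (∑ k ∈ Finset.range K, X x k ω) / (K : ℝ)) - p‖} ⊆
      ⋃ x, {ω | r * K ≤ |∑ k ∈ Finset.range K, X x k ω - K * p x|} := by
    intro ω hω
    by_contra h
    simp only [Set.mem_iUnion, Set.mem_ofPred_eq, not_exists, not_le] at h
    refine (not_lt.2 hω) ((pi_norm_lt_iff hr).2 fun x => ?_)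
    have e : (∑ k ∈ Finset.range K, X x k ω) / (K : ℝ) - p x =
        (∑ k ∈ Finset.range K, X x k ω - K * p x) / K := by field_simp
    rw [Pi.sub_apply, e, Real.norm_eq_abs, abs_div, abs_of_pos hK', div_lt_iff₀ hK']
    exact h x
  have hcell : ∀ x, P.real {ω | r * K ≤ |∑ k ∈ Finset.range K, X x k ω - K * p x|} ≤
      1 / (K * r ^ 2) := by
    intro x
    have hS : MemLp (fun ω => ∑ k ∈ Finset.range K, X x k ω) 2 P :=
      memLp_finsetSum _ fun k _ => hmem x k
    have hES : P[fun ω => ∑ k ∈ Finset.range K, X x k ω] = K * p x := by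
      rw [integral_finsetSum _ fun k _ => (hmem x k).integrable one_le_two]
      simp [hmean]
    have hVS : Var[fun ω => ∑ k ∈ Finset.range K, X x k ω; P] ≤ K := by
      have e : (fun ω => ∑ k ∈ Finset.range K, X x k ω) = ∑ k ∈ Finset.range K, X x k := by
        funext ω; simp
      rw [e, IndepFun.variance_sum (fun k _ => hmem x k)
        fun k _ k' _ hkk => hindep.indepFun (i := (x, k)) (j := (x, k')) (by simpa using hkk)]
      calc ∑ k ∈ Finset.range K, Var[X x k; P] ≤ ∑ k ∈ Finset.range K, (1 : ℝ) :=
            Finset.sum_le_sum fun k _ => hvar x k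
        _ = K := by simp
    have h := meas_ge_le_variance_div_sq hS (mul_pos hr hK')
    rw [hES] at h
    refine (ENNReal.toReal_le_of_le_ofReal
      (div_nonneg (variance_nonneg _ _) (sq_nonneg _)) h).trans ?_
    rw [div_le_div_iff₀ (by positivity) (by positivity)]
    calc _ ≤ (K : ℝ) * (K * r ^ 2) := by gcongr
      _ = _ := by ring
  calc _ ≤ P.real (⋃ x, {ω | r * K ≤ |∑ k ∈ Finset.range K, X x k ω - K * p x|}) :=
        measureReal_mono hsub
    _ ≤ ∑ x, P.real {ω | r * K ≤ |∑ k ∈ Finset.range K, X x k ω - K * p x|} :=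
        measureReal_iUnion_fintype_le _
    _ ≤ ∑ _x : ι, 1 / (K * r ^ 2) := Finset.sum_le_sum fun x _ => hcell x
    _ = _ := by simp [div_eq_mul_inv]

end Limit

/-! ### The matrices `J̄` and `K̄` as sums of outer products of gradients -/

section Matrices

variable {I J : ℕ} {β : ℝ} {w : Fin I → ℝ} {t : Fin J → ℝ} {α : Param}

theorem vecMulVec_failGrad (w t : ℝ) (α : Param) :
    Matrix.vecMulVec (failGrad w t α).ofLp (failGrad w t α).ofLp =
      (t ^ 2 * expf t (rate w α) ^ 2) • tempMatrix w α := by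
  ext k l
  fin_cases k <;> fin_cases l <;> simp [failGrad, tempMatrix, Matrix.vecMulVec_apply] <;> ring

theorem Jbar_eq : Jbar β w t α = ∑ x : Fin I × Fin J,
    lossWeight β (failProb (w x.1) (t x.2) α) •
      Matrix.vecMulVec (failGrad (w x.1) (t x.2) α).ofLp (failGrad (w x.1) (t x.2) α).ofLp := by
  simp_rw [Fintype.sum_prod_type, vecMulVec_failGrad, smul_smul, Jbar, Finset.sum_smul]
  refine Finset.sum_congr rfl fun i _ => Finset.sum_congr rfl fun j _ => ?_
  rw [mul_comm]
  rfl

/-- With `r = 1 - p`, `a = p ^ (β - 1)` and `b = r ^ (β - 1)`, this is the identity `a² p + b² r -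
(a p - b r)² = p r (a + b)²`. -/
theorem Kbar_eq (ht : ∀ j, 0 < t j) (hα : α ∈ paramSpace) :
    Kbar β w t α = ∑ x : Fin I × Fin J,
    (failProb (w x.1) (t x.2) α * (1 - failProb (w x.1) (t x.2) α) *
      lossWeight β (failProb (w x.1) (t x.2) α) ^ 2) •
      Matrix.vecMulVec (failGrad (w x.1) (t x.2) α).ofLp (failGrad (w x.1) (t x.2) α).ofLp := by
  simp_rw [Fintype.sum_prod_type, vecMulVec_failGrad, smul_smul, Kbar, Finset.sum_smul]
  refine Finset.sum_congr rfl fun i _ => Finset.sum_congr rfl fun j _ => ?_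
  congr 1
  have hp := failProb_mem_Ioo (w i) (ht j) hα
  have h0 : 0 < failProb (w i) (t j) α := hp.1
  have h1 : 0 < 1 - failProb (w i) (t j) α := sub_pos.2 hp.2
  rw [mul_comm]
  congr 1
  show failProb (w i) (t j) α ^ (2 * β - 1) + (1 - failProb (w i) (t j) α) ^ (2 * β - 1) -
    (failProb (w i) (t j) α ^ β - (1 - failProb (w i) (t j) α) ^ β) ^ 2 = _
  generalize hP : failProb (w i) (t j) α = p at h0 h1 ⊢
  generalize hR : 1 - p = r at h1 ⊢
  obtain rfl : p = 1 - r := by linarith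
  have e : ∀ s : ℝ, 0 < s → s ^ (2 * β - 1) = (s ^ (β - 1)) ^ 2 * s ∧ s ^ β = s ^ (β - 1) * s := by
    intro s hs
    constructor
    · rw [← Real.rpow_natCast (s ^ (β - 1)), ← Real.rpow_mul hs.le, ← Real.rpow_add_one hs.ne']
      congr 1; push_cast; ring
    · rw [← Real.rpow_add_one hs.ne']; congr 1; ring
  rw [lossWeight, sub_sub_cancel, (e r h1).1, (e r h1).2, (e _ h0).1, (e _ h0).2]
  ring

/-- Identifies `J̄` with the derivative of the score at zero residuals, so that its inverse solves
the linearised score equation. -/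
theorem Jbar_mulVec (v : Param) :
    (Jbar β w t α).mulVec v.ofLp = (∑ x : Fin I × Fin J,
      inner ℝ (failGrad (w x.1) (t x.2) α) v •
      lossWeight β (failProb (w x.1) (t x.2) α) • failGrad (w x.1) (t x.2) α).ofLp := by
  rw [Jbar_eq, Matrix.sum_mulVec, WithLp.ofLp_sum]
  refine Finset.sum_congr rfl fun x _ => ?_
  rw [Matrix.smul_mulVec, Matrix.vecMulVec_mulVec, WithLp.ofLp_smul, WithLp.ofLp_smul,
    EuclideanSpace.inner_eq_star_dotProduct, star_trivial, dotProduct_comm]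
  ext k
  simp
  ring

/-- Each gradient is a nonzero multiple of `(1 / α 0, w)`, and two such vectors with different `w`
span the plane. -/
theorem eq_zero_of_inner_failGrad_eq_zero {w₁ w₂ t₁ t₂ : ℝ} (hw : w₁ ≠ w₂) (h₁ : 0 < t₁)
    (h₂ : 0 < t₂) (hα : α ∈ paramSpace) {v : Param} (hv₁ : inner ℝ (failGrad w₁ t₁ α) v = 0)
    (hv₂ : inner ℝ (failGrad w₂ t₂ α) v = 0) : v = 0 := by
  have h0 : 0 < α 0 := hα
  have aux : ∀ {w t : ℝ}, 0 < t → inner ℝ (failGrad w t α) v = 0 →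
      1 / α 0 * v 0 + w * v 1 = 0 := by
    intro w t ht h
    have hc : t * expf t (rate w α) ≠ 0 := by unfold expf rate; positivity
    rw [failGrad, real_inner_smul_left, mul_eq_zero, or_iff_right hc] at h
    simpa [PiLp.inner_apply, Fin.sum_univ_two, mul_comm] using h
  have a₁ := aux h₁ hv₁
  have a₂ := aux h₂ hv₂
  have hv1 : v 1 = 0 := by
    have : (w₁ - w₂) * v 1 = 0 := by linear_combination a₁ - a₂
    exact (mul_eq_zero.1 this).resolve_left (sub_ne_zero.2 hw)
  have hv0 : v 0 = 0 := by
    rw [hv1, mul_zero, add_zero] at a₁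
    exact (mul_eq_zero.1 a₁).resolve_left (by positivity)
  ext k
  fin_cases k
  · exact hv0
  · exact hv1

/-- A kernel vector annihilates the quadratic form, a sum of positively weighted squares, and is
thus orthogonal to every gradient. -/
theorem isUnit_det_Jbar (hJ : 0 < J) (hw : ∃ i i', w i ≠ w i') (ht : ∀ j, 0 < t j)
    (hα : α ∈ paramSpace) : IsUnit (Jbar β w t α).det := by
  rw [isUnit_iff_ne_zero]
  intro hdet
  obtain ⟨v, hv, hv0⟩ := Matrix.exists_mulVec_eq_zero_iff.2 hdet
  have hsum := Jbar_mulVec (β := β) (w := w) (t := t) (α := α) (WithLp.toLp 2 v)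
  rw [hv0] at hsum
  have hzero : ∑ x : Fin I × Fin J, inner ℝ (failGrad (w x.1) (t x.2) α) (WithLp.toLp 2 v) •
      lossWeight β (failProb (w x.1) (t x.2) α) • failGrad (w x.1) (t x.2) α = 0 :=
    WithLp.ofLp_injective 2 hsum.symm
  have hq := congrArg (fun z => inner ℝ z (WithLp.toLp 2 v : Param)) hzero
  simp only [sum_inner, real_inner_smul_left, inner_zero_left] at hq
  have hb : ∀ x : Fin I × Fin J, 0 < lossWeight β (failProb (w x.1) (t x.2) α) := fun x =>
    lossWeight_pos β (failProb_mem_Ioo _ (ht x.2) hα)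
  have hall : ∀ x : Fin I × Fin J,
      inner ℝ (failGrad (w x.1) (t x.2) α) (WithLp.toLp 2 v : Param) = 0 := fun x => by
    have := (Finset.sum_eq_zero_iff_of_nonneg fun x _ => by
      nlinarith [mul_nonneg (hb x).le (mul_self_nonneg
        (inner ℝ (failGrad (w x.1) (t x.2) α) (WithLp.toLp 2 v : Param)))]).1 hq x
        (Finset.mem_univ x)
    have hb' := (hb x).ne'
    simpa [hb'] using this
  obtain ⟨i, i', hi⟩ := hw
  have := eq_zero_of_inner_failGrad_eq_zero hi (ht ⟨0, hJ⟩) (ht ⟨0, hJ⟩) hα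
    (hall (i, ⟨0, hJ⟩)) (hall (i', ⟨0, hJ⟩))
  exact hv (congrArg WithLp.ofLp this)

theorem transpose_Jbar_inv : ((Jbar β w t α)⁻¹).transpose = (Jbar β w t α)⁻¹ := by
  rw [Matrix.transpose_nonsing_inv, Jbar_eq, Matrix.transpose_sum]
  simp_rw [Matrix.transpose_smul, Matrix.transpose_vecMulVec]

theorem posSemidef_asymptoticCov (ht : ∀ j, 0 < t j) (hα : α ∈ paramSpace) :
    (asymptoticCov β w t α).PosSemidef := by
  have hK : (Kbar β w t α).PosSemidef := by
    rw [Kbar_eq ht hα]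
    refine Matrix.posSemidef_sum _ fun x _ => Matrix.PosSemidef.smul ?_ ?_
    · simpa using Matrix.posSemidef_vecMulVec_self_star (failGrad (w x.1) (t x.2) α).ofLp
    · have hp := failProb_mem_Ioo (w x.1) (ht x.2) hα
      exact mul_nonneg (mul_nonneg hp.1.le (sub_nonneg.2 hp.2.le)) (sq_nonneg _)
  have h := hK.mul_mul_conjTranspose_same (Jbar β w t α)⁻¹
  rwa [Matrix.conjTranspose_eq_transpose_of_trivial, transpose_Jbar_inv] at h

/-- The covariance hypothesis of the central limit theorem: `J̄⁻¹` is symmetric and can be moved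
across the inner product. -/
theorem dotProduct_asymptoticCov_mulVec (ht : ∀ j, 0 < t j) (hα : α ∈ paramSpace) (s : Param) :
    s.ofLp ⬝ᵥ (asymptoticCov β w t α).mulVec s.ofLp = ∑ x : Fin I × Fin J,
      failProb (w x.1) (t x.2) α * (1 - failProb (w x.1) (t x.2) α) *
      inner ℝ (Matrix.toEuclideanCLM (𝕜 := ℝ) (Jbar β w t α)⁻¹
        (lossWeight β (failProb (w x.1) (t x.2) α) • failGrad (w x.1) (t x.2) α)) s ^ 2 := by
  have hin : ∀ v : Param, inner ℝ (Matrix.toEuclideanCLM (𝕜 := ℝ) (Jbar β w t α)⁻¹ v) s =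
      v.ofLp ⬝ᵥ (Jbar β w t α)⁻¹.mulVec s.ofLp := fun v => by
    rw [EuclideanSpace.inner_eq_star_dotProduct, star_trivial, Matrix.ofLp_toEuclideanCLM,
      Matrix.dotProduct_mulVec, ← Matrix.mulVec_transpose, transpose_Jbar_inv,
      dotProduct_comm, dotProduct_comm, dotProduct_comm]
  have hquad : s.ofLp ⬝ᵥ (asymptoticCov β w t α).mulVec s.ofLp =
      (Jbar β w t α)⁻¹.mulVec s.ofLp ⬝ᵥ
        (Kbar β w t α).mulVec ((Jbar β w t α)⁻¹.mulVec s.ofLp) := by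
    rw [asymptoticCov, ← Matrix.mulVec_mulVec, ← Matrix.mulVec_mulVec, Matrix.dotProduct_mulVec,
      ← Matrix.mulVec_transpose, transpose_Jbar_inv]
  simp_rw [hquad, hin, Kbar_eq ht hα, Matrix.sum_mulVec, dotProduct_sum]
  refine Finset.sum_congr rfl fun x _ => ?_
  rw [Matrix.smul_mulVec, Matrix.vecMulVec_mulVec, WithLp.ofLp_smul, smul_dotProduct]
  simp only [op_smul_eq_smul, dotProduct_smul, smul_eq_mul]
  rw [dotProduct_comm _ (failGrad (w x.1) (t x.2) α).ofLp]
  ring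

end Matrices

/-! ### Moments of the Bernoulli observations -/

section Bernoulli

variable {Ω : Type*} [MeasurableSpace Ω] {P : Measure Ω}
  {p : unitInterval} {Y : Ω → ℕ}

theorem ae_eq_zero_or_eq_one (h : HasLaw Y (bernoulliMeasure 1 0 p) P) :
    ∀ᵐ ω ∂P, Y ω = 0 ∨ Y ω = 1 := by
  have h1 : ∀ᵐ n ∂(P.map Y), n = 0 ∨ n = 1 := by
    rw [h.map_eq, bernoulliMeasure_def, ae_add_measure_iff]
    constructor <;> refine Measure.ae_smul_measure ?_ _ <;> simp
  exact ae_of_ae_map h.aemeasurable h1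

theorem memLp_natCast_of_bernoulli [IsProbabilityMeasure P]
    (h : HasLaw Y (bernoulliMeasure 1 0 p) P) :
    MemLp (fun ω => (Y ω : ℝ)) 2 P := by
  refine MemLp.of_bound (measurable_from_nat.comp_aemeasurable h.aemeasurable).aestronglyMeasurable
    1 ?_
  filter_upwards [ae_eq_zero_or_eq_one h] with ω hω
  rcases hω with hω | hω <;> simp [hω]

theorem integral_natCast_of_bernoulli (h : HasLaw Y (bernoulliMeasure 1 0 p) P) :
    ∫ ω, (Y ω : ℝ) ∂P = p := by
  rw [← integral_map (f := fun n : ℕ => (n : ℝ)) h.aemeasurable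
    measurable_from_nat.aestronglyMeasurable, h.map_eq, integral_bernoulliMeasure]
  simp

theorem variance_natCast_of_bernoulli [IsProbabilityMeasure P]
    (h : HasLaw Y (bernoulliMeasure 1 0 p) P) :
    Var[fun ω => (Y ω : ℝ); P] = p * (1 - p) := by
  have hsq : ∫ ω, (Y ω : ℝ) ^ 2 ∂P = p := by
    rw [← integral_natCast_of_bernoulli h]
    refine integral_congr_ae ?_
    filter_upwards [ae_eq_zero_or_eq_one h] with ω hω
    rcases hω with hω | hω <;> simp [hω]
  rw [variance_eq_sub (memLp_natCast_of_bernoulli h), integral_natCast_of_bernoulli h]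
  simp only [Pi.pow_apply, hsq]
  ring

end Bernoulli

end OneShot

/-! ### Assembly of the asymptotic normality -/

theorem theorem6 {Ω : Type*} [MeasurableSpace Ω] (P : Measure Ω) [IsProbabilityMeasure P]
    {I J : ℕ} (hJ : 0 < J)
    (w : Fin I → ℝ) (hw : ∃ i i', w i ≠ w i')
    (t : Fin J → ℝ) (ht : ∀ j, 0 < t j)
    (α₀ : OneShot.Param) (hα₀ : α₀ ∈ OneShot.paramSpace)
    (y : Fin I → Fin J → ℕ → Ω → ℕ)
    (hy_indep : iIndepFun (fun x : Fin I × Fin J × ℕ => y x.1 x.2.1 x.2.2) P)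
    (hy_law : ∀ i j k,
      HasLaw (y i j k) (bernoulliMeasure 1 0 (OneShot.failProbI (w i) (ht j) hα₀)) P)
    (β : ℝ) (hβ : 0 ≤ β)
    (est : ℕ → Ω → OneShot.Param) (h_meas : ∀ K, AEMeasurable (est K) P)
    (h_est : ∀ K, ∀ᵐ ω ∂P, (∃ a, OneShot.IsMDPDE β w t K (fun i j k => y i j k ω) a) →
      OneShot.IsMDPDE β w t K (fun i j k => y i j k ω) (est K ω)) :
    Tendsto (fun K : ℕ => P {ω | ∃ a, OneShot.IsMDPDE β w t K (fun i j k => y i j k ω) a})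
        atTop (𝓝 1) ∧
      IsUnit (OneShot.Jbar β w t α₀).det ∧
      (OneShot.asymptoticCov β w t α₀).PosSemidef ∧
      TendstoInDistribution (fun (K : ℕ) ω => √(K : ℝ) • (est K ω - α₀)) atTop
        id (fun _ => P) (multivariateGaussian 0 (OneShot.asymptoticCov β w t α₀)) := by
  open OneShot in
  have hdet := isUnit_det_Jbar (β := β) hJ hw ht hα₀
  have hcov := posSemidef_asymptoticCov (β := β) (w := w) ht hα₀
  have hI : 0 < I := by
    obtain ⟨i, -⟩ := hw
    exact i.pos
  let W : Fin I × Fin J → ℝ := fun x => w x.1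
  let T : Fin I × Fin J → ℝ := fun x => t x.2
  have hT : ∀ x, 0 < T x := fun x => ht x.2
  have hW : ∃ x x', W x ≠ W x' := by
    obtain ⟨i, i', hi⟩ := hw
    exact ⟨(i, ⟨0, hJ⟩), (i', ⟨0, hJ⟩), hi⟩
  let p : Fin I × Fin J → ℝ := fun x => failProb (W x) (T x) α₀
  let X : Fin I × Fin J → ℕ → Ω → ℝ := fun x k ω => (y x.1 x.2 k ω : ℝ)
  have hXindep : iIndepFun (fun z : (Fin I × Fin J) × ℕ => X z.1 z.2) P :=
    (hy_indep.precomp (Equiv.prodAssoc (Fin I) (Fin J) ℕ).injective).comp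
      (fun _ (n : ℕ) => (n : ℝ)) fun _ => measurable_from_nat
  have hXmem : ∀ x k, MemLp (X x k) 2 P := fun x k =>
    memLp_natCast_of_bernoulli (hy_law x.1 x.2 k)
  have hXmean : ∀ x k, P[X x k] = p x := fun x k =>
    integral_natCast_of_bernoulli (hy_law x.1 x.2 k)
  have hXvar : ∀ x k, Var[X x k; P] = p x * (1 - p x) := fun x k =>
    variance_natCast_of_bernoulli (hy_law x.1 x.2 k)
  have hXident : ∀ x k, IdentDistrib (X x k) (X x 0) P P := fun x k =>
    IdentDistrib.comp (u := fun n : ℕ => (n : ℝ)) ⟨(hy_law x.1 x.2 k).aemeasurable,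
      (hy_law x.1 x.2 0).aemeasurable, by
        rw [(hy_law x.1 x.2 k).map_eq, (hy_law x.1 x.2 0).map_eq]⟩ measurable_from_nat
  let Q : ℕ → Ω → Fin I × Fin J → ℝ :=
    fun K ω x => (∑ k ∈ Finset.range K, X x k ω) / (K : ℝ)
  have hQ : ∀ K : ℕ, 0 < K → ∀ r : ℝ, 0 < r → P.real {ω | r ≤ ‖Q K ω - p‖} ≤
      (Fintype.card (Fin I × Fin J) : ℝ) / (K * r ^ 2) := fun K hK r hr =>
    measureReal_le_norm_mean_sub_le hXindep hXmem hXmean (fun x k => by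
      rw [hXvar x k]
      nlinarith [sq_nonneg (p x - 1 / 2)]) hK hr
  have hy01 : ∀ᵐ ω ∂P, ∀ i j k, y i j k ω = 0 ∨ y i j k ω = 1 :=
    ae_all_iff.2 fun i => ae_all_iff.2 fun j => ae_all_iff.2 fun k =>
      ae_eq_zero_or_eq_one (hy_law i j k)
  have hiff : ∀ K : ℕ, 0 < K → ∀ᵐ ω ∂P, ∀ a,
      IsMDPDE β w t K (fun i j k => y i j k ω) a ↔
        a ∈ paramSpace ∧ IsMinOn (totalLoss β W T (Q K ω)) paramSpace a := by
    intro K hK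
    filter_upwards [hy01] with ω hω a
    rw [isMDPDE_iff hI hJ hβ w ht hK hω a]
    simp only [failures, Nat.cast_sum]
    rfl
  refine ⟨?_, hdet, hcov, ?_⟩
  · obtain ⟨r, hr, hball⟩ := Metric.eventually_nhds_iff.1
      (eventually_exists_isMinOn_totalLoss hβ hT hW hα₀ univ_mem)
    have hlow : Tendsto (fun K : ℕ => 1 - ENNReal.ofReal
        ((Fintype.card (Fin I × Fin J) : ℝ) / (K * r ^ 2))) atTop (𝓝 1) := by
      have h : Tendsto (fun K : ℕ => (Fintype.card (Fin I × Fin J) : ℝ) / (K * r ^ 2)) atTop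
          (𝓝 0) := tendsto_const_nhds.div_atTop
        (tendsto_natCast_atTop_atTop.atTop_mul_const (by positivity))
      simpa using ENNReal.Tendsto.sub (tendsto_const_nhds (x := (1 : ENNReal)))
        (ENNReal.tendsto_ofReal h) (Or.inl ENNReal.one_ne_top)
    refine tendsto_of_tendsto_of_tendsto_of_le_of_le' hlow tendsto_const_nhds ?_
      (Eventually.of_forall fun K => prob_le_one)
    filter_upwards [eventually_gt_atTop 0] with K hK
    have hcover : (Set.univ : Set Ω) ≤ᵐ[P]
        ({ω | ∃ a, IsMDPDE β w t K (fun i j k => y i j k ω) a} ∪ {ω | r ≤ ‖Q K ω - p‖} :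
          Set Ω) := by
      filter_upwards [hiff K hK] with ω hω _
      by_cases hb : r ≤ ‖Q K ω - p‖
      · exact Or.inr hb
      · obtain ⟨⟨a, ha⟩, -⟩ := hball (y := Q K ω) (by rw [dist_eq_norm]; exact not_le.1 hb)
        exact Or.inl ⟨a, (hω a).2 ha⟩
    rw [tsub_le_iff_right]
    calc (1 : ENNReal) = P Set.univ := measure_univ.symm
      _ ≤ _ := (measure_mono_ae hcover).trans (measure_union_le _ _)
      _ ≤ _ := by
        gcongr
        rw [← ofReal_measureReal]
        exact ENNReal.ofReal_le_ofReal (hQ K hK r hr)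
  · let A : Param →L[ℝ] Param := Matrix.toEuclideanCLM (𝕜 := ℝ) (Jbar β w t α₀)⁻¹
    have hA : ∀ v, A (∑ x, inner ℝ (failGrad (W x) (T x) α₀) v •
        lossWeight β (failProb (W x) (T x) α₀) • failGrad (W x) (T x) α₀) = v := fun v => by
      apply WithLp.ofLp_injective 2
      rw [Matrix.ofLp_toEuclideanCLM]
      show (Jbar β w t α₀)⁻¹.mulVec (∑ x : Fin I × Fin J,
        inner ℝ (failGrad (w x.1) (t x.2) α₀) v •
        lossWeight β (failProb (w x.1) (t x.2) α₀) • failGrad (w x.1) (t x.2) α₀).ofLp = v.ofLp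
      rw [← Jbar_mulVec, Matrix.mulVec_mulVec, Matrix.nonsing_inv_mul _ hdet, Matrix.one_mulVec]
    let c : Fin I × Fin J → Param := fun x =>
      A (lossWeight β (failProb (W x) (T x) α₀) • failGrad (W x) (T x) α₀)
    have hclt := tendstoInDistribution_sum_smul_rows hXindep hXident (fun x => hXmem x 0) c hcov
      fun s => by
        rw [dotProduct_asymptoticCov_mulVec ht hα₀]
        exact Finset.sum_congr rfl fun x _ => by rw [hXvar x 0]
    -- Slutsky: only the difference from the linear term remains to be shown negligible.
    refine tendstoInDistribution_of_tendstoInMeasure_sub _ _ hclt ?_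
      fun K => ((h_meas K).sub_const α₀).const_smul (√(K : ℝ))
    have hrem := tendstoInMeasure_sqrt_smul (P := P) (Q := Q) (p := p)
      (D := fun K ω => est K ω - α₀ - ∑ x, (Q K ω x - p x) • c x) (Nat.cast_nonneg _) hQ
      fun ε hε => by
        -- Existence is included in the neighbourhood because the estimator is a minimiser only when
        -- one exists.
        refine ⟨_, (eventually_exists_isMinOn_totalLoss hβ hT hW hα₀ univ_mem).and
          (eventually_norm_isMinOn_totalLoss_sub_le hβ hT hW hα₀ A hA hε), fun K hK => ?_⟩
        filter_upwards [hiff K hK, h_est K] with ω h1 h2 hq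
        obtain ⟨⟨⟨a, ha⟩, -⟩, hlin⟩ := hq
        have hmin := (h1 _).1 (h2 ⟨a, (h1 a).2 ha⟩)
        exact hlin _ hmin.1 hmin.2
    convert hrem using 1
    funext K ω
    -- For `K = 0` both sides vanish, as `√0 = 0` and its inverse is `0`.
    rcases Nat.eq_zero_or_pos K with rfl | hK
    · simp
    · have hK' : (0 : ℝ) < K := by exact_mod_cast hK
      simp only [Pi.sub_apply, smul_sub, Finset.smul_sum, smul_smul]
      congr 1
      refine Finset.sum_congr rfl fun x _ => ?_
      rw [hXmean x 0]
      congr 1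
      have hs := Real.mul_self_sqrt hK'.le
      have hs0 : 0 < √(K : ℝ) := Real.sqrt_pos.2 hK'
      simp only [Q]
      rw [inv_mul_eq_div, div_eq_iff hs0.ne', mul_right_comm, hs]
      field_simp
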